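/- Let $p$ be a probability mass function on $\mathbb{Z}$, let $X, X_1,X_2,\dots$ be i.i.d. with mass function $p$, and put $S_n=X_1+\cdots+X_n$, $p_n(z)=\mathbb{P}(S_n=z)$. Assume: (D1) $\{x\in\mathbb{Z}: p(x)>0\}=[\alpha,\beta]\cap\mathbb{Z}$ for some $\alpha\in\mathbb{Z}\cup\{-\infty\}$ and $\beta\in\mathbb{Z}\cup\{\infty\}$ with $\alpha<\beta$; (D2) $\mathbb{E}[e^{\lambda|X|}]<\infty$ for some $\lambda>0$; (D3) $\Lambda(t)=\log\mathbb{E}[e^{tX}]\in(-\infty,\infty]$ is lower semicontinuous on $\mathbb{R}$; (D4) there are $D,d>0$ such that $p(x)\le De^{-dx^2}$ for all $x\ge 0$, or $p(x)\le De^{-dx^2}$ for all $x\le 0$. For functions $\hat C,\hat a:(0,\infty)\to(0,\infty)$ say that D5 holds with $(\hat C,\hat a)$ if for all $n\ge1$, all $z\in L_n:=[n\alpha,n\beta]\cap\mathbb{Z}$ and all $\hat b>0$ $$\mathbb{E}\Big[\exp\Big(\hat a(\hat b)\max_{1\le k\le n}|S_k|\Big)\,\Big|\,S_n=z\Big]\le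 \hat C(\hat b)\exp\big(\hat b(n+z^2/n)\big),$$ and that $p$ satisfies D5 if this holds with some such $(\hat C,\hat a)$. A function $f:\mathbb{Z}\to[0,\infty)$ is unimodal if for some $M\in\mathbb{Z}$ one has $f(n-1)\le f(n)$ for $n\le M$ and $f(n+1)\le f(n)$ for $n\ge M$; $p$ is strongly unimodal if its convolution with every unimodal probability mass function on $\mathbb{Z}$ is unimodal (by a theorem of Keilson and Gerber this is equivalent to $p(n)^2\ge p(n-1)p(n+1)$ for all $n$). Then $p$ satisfies D5 if $\alpha>-\infty$, or $\beta<\infty$, or $\alpha=-\infty$, $\beta=\infty$ and $p$ is strongly unimodal. Moreover: (i) If $\alpha>-\infty$, then D5 holds with $\hat C(\hat b)=1$ and $\hat a(\hat b)=\hat b/(1+\hat b+|\alpha|)$. (ii) If $\beta<\infty$, then D5 holds with $\hat C(\hat b)=1$ and $\hat a(\hat b)=\hat b/(1+\hat b+|\beta|)$. (iii) Suppose $\alpha=-\infty$, $\beta=\infty$ and $p$ is strongly unimodal. Let $\mu=\mathbb{E}[X]$ and let $\lambda>0$ satisfy $\mathbb{E}[e^{\lambda|X|}]<\infty$. Then there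 are constants $\Delta, C_R,c_R,\hat C_R,\hat c_R>0$ and $R>|\mu|+1+\Delta^{-1}$ such that for all $n\ge1$ $$p_n(\lfloor\mu n\rfloor)\ge \Delta n^{-1/2},\qquad p_n(z)\ge C_Rn^{-1/2}e^{-c_Rn}\ \text{ for all } z\in\mathbb{Z} \text{ with } |z|\le 2Rn,$$ $$\mathbb{E}[e^{\lambda|X|}]^n\Big[\frac{4n^{3/2}}{\Delta}+C_R^{-1}\sqrt n\,e^{c_Rn}\Big]\le\hat C_Re^{\hat c_Rn}.$$ For any such constants, D5 holds with $\hat a(\hat b)=\lambda v^{-1}$ and $\hat C(\hat b)=\hat C_R^{1/v}$, where for each $\hat b>0$, $v=v(\hat b)\ge1$ is any integer with $\hat c_Rv^{-1}\le\hat b/2$ and $\lambda v^{-1}\le\hat b/2$. -/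

import Mathlib

open MeasureTheory ProbabilityTheory
open scoped ENNReal

noncomputable section

namespace DiscreteBridge

/-- `p` is positive exactly on the integers between `α` and `β`, where
`α ∈ ℤ ∪ {-∞}`, `β ∈ ℤ ∪ {∞}` and `α < β`. -/
structure IntervalSupport (p : PMF ℤ) (α : WithBot ℤ) (β : WithTop ℤ) : Prop where
  pos_iff : ∀ x : ℤ, 0 < p x ↔ α ≤ (x : WithBot ℤ) ∧ (x : WithTop ℤ) ≤ β
  lt : ∀ a b : ℤ, α = (a : WithBot ℤ) → β = (b : WithTop ℤ) → a < b

/-- The exponential moment `E[exp(l |X|)]`, as an element of `[0, ∞]`. -/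
def absMGF (p : PMF ℤ) (l : ℝ) : ℝ≥0∞ :=
  ∫⁻ x : ℤ, ENNReal.ofReal (Real.exp (l * |(x : ℝ)|)) ∂p.toMeasure

/-- Some exponential moment of `|X|` is finite. -/
def HasExpMoment (p : PMF ℤ) : Prop :=
  ∃ l : ℝ, 0 < l ∧ absMGF p l < ∞

/-- The log-moment generating function `Λ(t) = log E[exp(t X)]`, which may be infinite. -/
def logMGF (p : PMF ℤ) (t : ℝ) : EReal :=
  ENNReal.log (∫⁻ x : ℤ, ENNReal.ofReal (Real.exp (t * (x : ℝ))) ∂p.toMeasure)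

/-- `p` has a Gaussian upper bound on at least one of the two half-lines. -/
def OneSidedGaussianTail (p : PMF ℤ) : Prop :=
  ∃ D d : ℝ, 0 < D ∧ 0 < d ∧
    ((∀ x : ℤ, 0 ≤ x → (p x).toReal ≤ D * Real.exp (-d * (x : ℝ) ^ 2)) ∨
     (∀ x : ℤ, x ≤ 0 → (p x).toReal ≤ D * Real.exp (-d * (x : ℝ) ^ 2)))

/-- The law of an i.i.d. sequence with mass function `p`: the coordinates
`ω 0, ω 1, …` are the steps `X₁, X₂, …`. -/
def stepsLaw (p : PMF ℤ) : Measure (ℕ → ℤ) :=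
  Measure.infinitePi (fun _ : ℕ => p.toMeasure)

/-- The random walk `S_n = X₁ + ⋯ + X_n`. -/
def walk (n : ℕ) (ω : ℕ → ℤ) : ℤ := ∑ i ∈ Finset.range n, ω i

/-- The mass function `p_n(z) = P(S_n = z)` of the walk at time `n`. -/
def walkMass (p : PMF ℤ) (n : ℕ) (z : ℤ) : ℝ :=
  (stepsLaw p).real {ω | walk n ω = z}

/-- `max_{1 ≤ k ≤ n} |S_k|`. -/
def maxAbsWalk (n : ℕ) (ω : ℕ → ℤ) : ℕ :=
  (Finset.Icc 1 n).sup (fun k => (walk k ω).natAbs)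

/-- `L_n = [n α, n β] ∩ ℤ`, the set of admissible endpoints of a bridge of length `n`. -/
def endpoints (α : WithBot ℤ) (β : WithTop ℤ) (n : ℕ) : Set ℤ :=
  {z | (∀ a : ℤ, α = (a : WithBot ℤ) → (n : ℤ) * a ≤ z) ∧
       (∀ b : ℤ, β = (b : WithTop ℤ) → z ≤ (n : ℤ) * b)}

/-- `E[exp(a max_{1 ≤ k ≤ n} |S_k|) | S_n = z]`, as an element of `[0, ∞]`. -/
def bridgeMaxMoment (p : PMF ℤ) (a : ℝ) (n : ℕ) (z : ℤ) : ℝ≥0∞ :=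
  ∫⁻ ω, ENNReal.ofReal (Real.exp (a * (maxAbsWalk n ω : ℝ)))
    ∂(ProbabilityTheory.cond (stepsLaw p) {ω | walk n ω = z})

/-- The bridge maximum satisfies the exponential estimate with the positive functions
`C` and `a` of the parameter `b > 0`. -/
def BridgeMaxBoundWith (p : PMF ℤ) (α : WithBot ℤ) (β : WithTop ℤ) (C a : ℝ → ℝ) : Prop :=
  (∀ b : ℝ, 0 < b → 0 < C b ∧ 0 < a b) ∧
  ∀ n : ℕ, 1 ≤ n → ∀ z ∈ endpoints α β n, ∀ b : ℝ, 0 < b →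
    bridgeMaxMoment p (a b) n z ≤
      ENNReal.ofReal (C b * Real.exp (b * ((n : ℝ) + (z : ℝ) ^ 2 / (n : ℝ))))

/-- The exponential estimate for the bridge maximum holds for some functions `C` and `a`. -/
def BridgeMaxBound (p : PMF ℤ) (α : WithBot ℤ) (β : WithTop ℤ) : Prop :=
  ∃ C a : ℝ → ℝ, BridgeMaxBoundWith p α β C a

/-- A function on `ℤ` is unimodal if it is nondecreasing up to some integer and
nonincreasing from it on. -/
def Unimodal (f : ℤ → ℝ≥0∞) : Prop :=
  ∃ M : ℤ, (∀ n : ℤ, n ≤ M → f (n - 1) ≤ f n) ∧ (∀ n : ℤ, M ≤ n → f (n + 1) ≤ f n)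

/-- The convolution of two mass functions. -/
def convMass (p h : PMF ℤ) (n : ℤ) : ℝ≥0∞ := ∑' k : ℤ, p k * h (n - k)

/-- The convolution of `p` with every unimodal mass function is unimodal. -/
def StronglyUnimodal (p : PMF ℤ) : Prop :=
  ∀ h : PMF ℤ, Unimodal h → Unimodal (convMass p h)

/-- The mean `E[X]`. -/
def mean (p : PMF ℤ) : ℝ := ∫ x : ℤ, (x : ℝ) ∂p.toMeasure

/-- The constants `Δ, R, C, c, Chat, chat` are admissible for `p` (of full support) and the
exponent `l`, for which `E[exp(l |X|)]` is finite. -/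
structure AdmissibleConstants (p : PMF ℤ) (l Δ R C c Chat chat : ℝ) : Prop where
  Δ_pos : 0 < Δ
  mean_lower : ∀ n : ℕ, 1 ≤ n → Δ / √(n : ℝ) ≤ walkMass p n ⌊mean p * (n : ℝ)⌋
  R_gt : |mean p| + 1 + Δ⁻¹ < R
  C_pos : 0 < C
  c_pos : 0 < c
  lower : ∀ n : ℕ, 1 ≤ n → ∀ z : ℤ, |(z : ℝ)| ≤ 2 * R * (n : ℝ) →
    C / √(n : ℝ) * Real.exp (-c * (n : ℝ)) ≤ walkMass p n z
  Chat_pos : 0 < Chat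
  chat_pos : 0 < chat
  upper : ∀ n : ℕ, 1 ≤ n →
    (absMGF p l).toReal ^ n *
        (4 * (n : ℝ) ^ (3 / 2 : ℝ) / Δ + C⁻¹ * √(n : ℝ) * Real.exp (c * (n : ℝ)))
      ≤ Chat * Real.exp (chat * (n : ℝ))

end DiscreteBridge

end

/-!
The bridge `(S_k)` conditioned on `S_n = z` is controlled in two different ways.

If all steps are at least `a` (or all at most `a`), then deterministically `S_k` lies between
`k a` and `z - (n - k) a`, so `|S_k| ≤ |z| + n |a|` for every `k`, and `2 |z| ≤ n + z² / n`
gives the estimate (`bridgeMaxBoundWith_of_bounded_side`).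

For strongly unimodal `p` of full support the masses `p_n` are unimodal. By Jensen's inequality
(`bridgeMaxMoment_div_le`) it suffices to bound the moment with exponent `l` by
`Chat * exp (chat n + (3/2) l |z|)`. If `|z| ≤ 2 R n`, the numerator is at most `E[exp (l |X|)] ^ n`
and `p_n(z)` is bounded below exponentially (`AdmissibleConstants.setLIntegral_le_of_abs_le`).
If `|z| > 2 R n`, one sums `exp (l |y|) p_k(y) p_{n-k}(z - y)` over `k` and `y`. The lower bound
`p_m(⌊μ m⌋) ≥ Δ / √m` puts the mode of `p_m` within `√m / Δ` of `⌊μ m⌋`, so for `z > 0` and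
`y ≥ z - ⌊μ (n - k)⌋`, the point `y` lies beyond the mode of `p_k` and
`p_k(y) (Δ / √n) ≤ p_k(z - ⌊μ (n - k)⌋) p_{n-k}(⌊μ (n - k)⌋) ≤ p_n(z)`. Symmetrically
`p_{n-k}(z - y)` is small for `y ≤ ⌊μ k⌋`, and for the remaining `y` one has `|y| ≤ (3/2) |z|`;
negative `z` follows by reflection (`small_factor_or_abs_le`,
`AdmissibleConstants.setLIntegral_le_of_lt_abs`).

Admissible constants exist (`exists_admissibleConstants`): the central limit theorem yields points
on both sides of `μ n` with mass of order `1 / √n`, unimodality carries this bound to `⌊μ n⌋`, and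
the exponential lower bound comes from writing `z` as a sum of `n` bounded steps.
-/

namespace DiscreteBridge

/-! ### The walk: independence, convolution and exponential moments -/

instance isProbabilityMeasure_stepsLaw (p : PMF ℤ) : IsProbabilityMeasure (stepsLaw p) := by
  unfold stepsLaw; infer_instance

theorem measurable_walk (n : ℕ) : Measurable (walk n) := by
  unfold walk; fun_prop

/-- The mass function `P(S_n = z)` of the walk, as an element of `[0, ∞]`. -/
noncomputable def walkProb (p : PMF ℤ) (n : ℕ) (z : ℤ) : ℝ≥0∞ := stepsLaw p {ω | walk n ω = z}

theorem walkProb_ne_top (p : PMF ℤ) (n : ℕ) (z : ℤ) : walkProb p n z ≠ ∞ :=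
  measure_ne_top _ _

theorem ofReal_walkMass (p : PMF ℤ) (n : ℕ) (z : ℤ) :
    ENNReal.ofReal (walkMass p n z) = walkProb p n z :=
  ENNReal.ofReal_toReal (walkProb_ne_top p n z)

theorem iIndepFun_steps (p : PMF ℤ) : iIndepFun (fun i (ω : ℕ → ℤ) => ω i) (stepsLaw p) :=
  iIndepFun_infinitePi (X := fun _ x => x) fun _ => measurable_id

theorem map_step (p : PMF ℤ) (i : ℕ) : (stepsLaw p).map (fun ω => ω i) = p.toMeasure :=
  Measure.infinitePi_map_eval _ i

theorem map_shift (p : PMF ℤ) (k : ℕ) :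
    (stepsLaw p).map (fun ω i => ω (k + i)) = stepsLaw p :=
  Measure.map_infinitePi_infinitePi_of_inj (P := fun _ : ℕ => p.toMeasure)
    (add_right_injective k)

theorem walk_add (k m : ℕ) (ω : ℕ → ℤ) :
    walk (k + m) ω = walk k ω + walk m (fun i => ω (k + i)) :=
  Finset.sum_range_add _ _ _

theorem indepFun_walk_shift (p : PMF ℤ) (k m : ℕ) :
    IndepFun (walk k) (fun ω => walk m (fun i => ω (k + i))) (stepsLaw p) := by
  have h := (iIndepFun_steps p).indepFun_finset (Finset.range k) (Finset.Ico k (k + m))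
    (by rw [Finset.disjoint_left]; intro i; simp; omega) (fun i => by fun_prop)
  have h2 := h.comp (φ := fun x => ∑ i, x i) (ψ := fun x => ∑ i, x i)
    (by fun_prop) (by fun_prop)
  convert! h2 using 1
  · ext ω
    exact (Finset.sum_coe_sort (Finset.range k) ω).symm
  · ext ω
    simp only [walk, Function.comp]
    rw [Finset.sum_coe_sort (Finset.Ico k (k + m)) ω, Finset.sum_Ico_eq_sum_range]
    simp

theorem measure_walk_eq_inter (p : PMF ℤ) (k m : ℕ) (y z : ℤ) :
    stepsLaw p ({ω | walk k ω = y} ∩ {ω | walk (k + m) ω = z}) =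
      walkProb p k y * walkProb p m (z - y) := by
  have h : ({ω | walk k ω = y} ∩ {ω | walk (k + m) ω = z}) =
      walk k ⁻¹' {y} ∩ (fun ω => walk m (fun i => ω (k + i))) ⁻¹' {z - y} := by
    ext ω
    simp only [walk_add, Set.mem_inter_iff, Set.mem_ofPred_eq, Set.mem_preimage,
      Set.mem_singleton_iff]
    omega
  rw [h, (indepFun_walk_shift p k m).measure_inter_preimage_eq_mul _ _ (measurableSet_singleton _)
    (measurableSet_singleton _)]
  congr 1
  conv_rhs => rw [walkProb, ← map_shift p k]
  exact (Measure.map_apply (by fun_prop) (measurable_walk m (measurableSet_singleton _))).symm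

/-- Integrating a function of `S_k` over the event `S_{k+m} = z`. -/
theorem setLIntegral_walk_eq (p : PMF ℤ) (k m : ℕ) (z : ℤ) (F : ℤ → ℝ≥0∞) :
    ∫⁻ ω in {ω | walk (k + m) ω = z}, F (walk k ω) ∂(stepsLaw p) =
      ∑' y, F y * (walkProb p k y * walkProb p m (z - y)) := by
  rw [← lintegral_map (f := F) (measurable_of_countable F) (measurable_walk k),
    lintegral_countable']
  congr with y
  rw [Measure.map_apply (measurable_walk k) (measurableSet_singleton _),
    Measure.restrict_apply (measurable_walk k (measurableSet_singleton _)),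
    ← measure_walk_eq_inter]
  rfl

theorem lintegral_walk (p : PMF ℤ) (k : ℕ) (F : ℤ → ℝ≥0∞) :
    ∫⁻ ω, F (walk k ω) ∂(stepsLaw p) = ∑' y, F y * walkProb p k y := by
  rw [← lintegral_map (f := F) (measurable_of_countable F) (measurable_walk k),
    lintegral_countable']
  congr with y
  rw [Measure.map_apply (measurable_walk k) (measurableSet_singleton _)]
  rfl

theorem tsum_walkProb (p : PMF ℤ) (k : ℕ) : ∑' y, walkProb p k y = 1 := by
  have := lintegral_walk p k 1
  simpa using this.symm

theorem walkProb_add (p : PMF ℤ) (k m : ℕ) (z : ℤ) :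
    walkProb p (k + m) z = ∑' y, walkProb p k y * walkProb p m (z - y) := by
  simpa [walkProb] using setLIntegral_walk_eq p k m z 1

theorem walkProb_mul_le (p : PMF ℤ) (k m : ℕ) (y w : ℤ) :
    walkProb p k y * walkProb p m w ≤ walkProb p (k + m) (y + w) := by
  rw [walkProb_add]
  simpa using ENNReal.le_tsum (f := fun x => walkProb p k x * walkProb p m (y + w - x)) y

theorem walkProb_zero (p : PMF ℤ) (z : ℤ) : walkProb p 0 z = if z = 0 then 1 else 0 := by
  split_ifs with h
  · simp [walkProb, walk, h]
  · simp [walkProb, walk, Ne.symm h]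

theorem walkProb_one (p : PMF ℤ) (z : ℤ) : walkProb p 1 z = p z := by
  have h : {ω : ℕ → ℤ | walk 1 ω = z} = (fun ω => ω 0) ⁻¹' {z} := by
    ext ω; simp [walk]
  rw [walkProb, h, ← Measure.map_apply (by fun_prop) (measurableSet_singleton _), map_step,
    PMF.toMeasure_apply_singleton _ _ (measurableSet_singleton _)]

/-- The law of a strongly unimodal walk is unimodal at every time, including the
point mass at time `0`. -/
theorem unimodal_walkProb {p : PMF ℤ} (hp : StronglyUnimodal p) (n : ℕ) :
    Unimodal (walkProb p n) := by
  induction n with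
  | zero =>
    refine ⟨0, fun n hn => ?_, fun n hn => ?_⟩
    · rw [walkProb_zero, if_neg (by omega)]; exact zero_le
    · rw [walkProb_zero, if_neg (by omega)]; exact zero_le
  | succ n ih =>
    have h := hp ⟨walkProb p n, by
      rw [← tsum_walkProb p n]; exact ENNReal.summable.hasSum⟩ ih
    convert h using 1
    ext z
    rw [add_comm, walkProb_add]
    simp only [walkProb_one]
    rfl

/-- The moment generating function at `l` of `|X₁| + ⋯ + |X_n|` is the `n`-th power of that
of `|X|`. -/
theorem lintegral_exp_sum_abs (p : PMF ℤ) (l : ℝ) (n : ℕ) :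
    ∫⁻ ω, ENNReal.ofReal (Real.exp (l * ∑ i ∈ Finset.range n, |(ω i : ℝ)|)) ∂(stepsLaw p) =
      absMGF p l ^ n := by
  have h := lintegral_prod_eq_prod_lintegral_of_indepFun (Finset.range n)
    (fun i (ω : ℕ → ℤ) => ENNReal.ofReal (Real.exp (l * |(ω i : ℝ)|)))
    ((iIndepFun_steps p).comp (fun _ x => ENNReal.ofReal (Real.exp (l * |(x : ℝ)|)))
      (fun _ => measurable_of_countable _)) (fun i => by fun_prop)
  have h2 (i : ℕ) : ∫⁻ ω, ENNReal.ofReal (Real.exp (l * |(ω i : ℝ)|)) ∂(stepsLaw p) =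
      absMGF p l := by
    rw [absMGF, ← map_step p i, lintegral_map (measurable_of_countable _) (by fun_prop)]
  simp only [h2, Finset.prod_const, Finset.card_range] at h
  rw [← h]
  congr with ω
  rw [Finset.mul_sum, Real.exp_sum, ENNReal.ofReal_prod_of_nonneg fun _ _ => (Real.exp_pos _).le]

theorem abs_walk_le {k n : ℕ} (h : k ≤ n) (ω : ℕ → ℤ) :
    |(walk k ω : ℝ)| ≤ ∑ i ∈ Finset.range n, |(ω i : ℝ)| := by
  unfold walk
  push_cast
  exact (Finset.abs_sum_le_sum_abs _ _).trans
    (Finset.sum_le_sum_of_subset_of_nonneg (Finset.range_mono h) fun _ _ _ => abs_nonneg _)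

theorem tsum_exp_mul_walkProb_le (p : PMF ℤ) {l : ℝ} (hl : 0 ≤ l) (k : ℕ) :
    ∑' y : ℤ, ENNReal.ofReal (Real.exp (l * |(y : ℝ)|)) * walkProb p k y ≤ absMGF p l ^ k := by
  rw [← lintegral_walk p k fun y => ENNReal.ofReal (Real.exp (l * |(y : ℝ)|)),
    ← lintegral_exp_sum_abs]
  refine lintegral_mono fun ω => ?_
  gcongr
  exact abs_walk_le le_rfl ω

theorem one_le_absMGF (p : PMF ℤ) {l : ℝ} (hl : 0 ≤ l) : 1 ≤ absMGF p l := by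
  calc (1 : ℝ≥0∞) = ∫⁻ _ : ℤ, 1 ∂p.toMeasure := by simp
    _ ≤ _ := by
      refine lintegral_mono fun x => ?_
      rw [← ENNReal.ofReal_one]
      exact ENNReal.ofReal_le_ofReal (Real.one_le_exp (by positivity))

theorem maxAbsWalk_le_iff (n : ℕ) (ω : ℕ → ℤ) {r : ℝ} (hr : 0 ≤ r) :
    (maxAbsWalk n ω : ℝ) ≤ r ↔ ∀ k ∈ Finset.Icc 1 n, |(walk k ω : ℝ)| ≤ r := by
  rw [← Nat.le_floor_iff hr, maxAbsWalk, Finset.sup_le_iff]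
  refine forall₂_congr fun k _ => ?_
  rw [Nat.le_floor_iff hr, Nat.cast_natAbs, Int.cast_abs]

theorem measurable_maxAbsWalk (n : ℕ) : Measurable (maxAbsWalk n) := by
  unfold maxAbsWalk
  induction Finset.Icc 1 n using Finset.cons_induction with
  | empty => simp
  | cons k s hk ih =>
    simp only [Finset.sup_cons]
    exact ((measurable_of_countable Int.natAbs).comp (measurable_walk k)).sup ih

/-- The maximum of `|S_k|` is attained, so its exponential is at most the sum of the
exponentials of the `|S_k|`. -/
theorem exp_maxAbsWalk_le_sum (l : ℝ) {n : ℕ} (hn : 1 ≤ n) (ω : ℕ → ℤ) :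
    ENNReal.ofReal (Real.exp (l * (maxAbsWalk n ω : ℝ))) ≤
      ∑ k ∈ Finset.Icc 1 n, ENNReal.ofReal (Real.exp (l * |(walk k ω : ℝ)|)) := by
  obtain ⟨k, hk, h⟩ := Finset.exists_mem_eq_sup (Finset.Icc 1 n) ⟨1, by simpa using hn⟩
    fun k => (walk k ω).natAbs
  rw [maxAbsWalk, h, Nat.cast_natAbs, Int.cast_abs]
  exact Finset.single_le_sum (f := fun k => ENNReal.ofReal (Real.exp (l * |(walk k ω : ℝ)|)))
    (fun _ _ => zero_le) hk

/-- An integral over the event `S_n = z` controls the conditional expectation; no positivity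
of the event is needed, since conditioning on a null event gives the zero measure. -/
theorem bridgeMaxMoment_le {p : PMF ℤ} {a : ℝ} {n : ℕ} {z : ℤ} {B : ℝ≥0∞}
    (h : ∫⁻ ω in {ω | walk n ω = z}, ENNReal.ofReal (Real.exp (a * (maxAbsWalk n ω : ℝ)))
      ∂(stepsLaw p) ≤ walkProb p n z * B) : bridgeMaxMoment p a n z ≤ B := by
  rw [bridgeMaxMoment, ProbabilityTheory.cond, lintegral_smul_measure]
  calc _ ≤ (stepsLaw p {ω | walk n ω = z})⁻¹ * (walkProb p n z * B) := by
        rw [smul_eq_mul]; gcongr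
    _ = ((walkProb p n z)⁻¹ * walkProb p n z) * B := by rw [mul_assoc]; rfl
    _ ≤ 1 * B := by gcongr; exact ENNReal.inv_mul_le_one _
    _ = B := one_mul B

/-! ### Steps bounded on one side -/

theorem ae_steps_pos (p : PMF ℤ) : ∀ᵐ ω ∂(stepsLaw p), ∀ i, 0 < p (ω i) := by
  rw [ae_all_iff]
  intro i
  have h : ∀ᵐ x ∂p.toMeasure, 0 < p x := by
    rw [ae_iff_of_countable]
    intro x hx
    rw [PMF.toMeasure_apply_singleton _ _ (measurableSet_singleton _)] at hx
    exact pos_iff_ne_zero.2 hx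
  rw [← map_step p i] at h
  have hm : Measurable fun ω : ℕ → ℤ => ω i := measurable_pi_apply i
  exact ae_of_ae_map (p := fun x => 0 < p x) hm.aemeasurable h

theorem mul_le_walk {a : ℤ} {ω : ℕ → ℤ} (h : ∀ i, a ≤ ω i) (k : ℕ) : k * a ≤ walk k ω := by
  simpa [walk] using Finset.card_nsmul_le_sum (Finset.range k) ω a fun i _ => h i

theorem walk_le_mul {a : ℤ} {ω : ℕ → ℤ} (h : ∀ i, ω i ≤ a) (k : ℕ) : walk k ω ≤ k * a := by
  simpa [walk] using Finset.sum_le_card_nsmul (Finset.range k) ω a fun i _ => h i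

/-- If all steps lie on one side of `a`, every intermediate position is between `k a` and
`S_n - (n - k) a`. -/
theorem abs_walk_le_of_bounded_side {a : ℤ} {ω : ℕ → ℤ} (h : (∀ i, a ≤ ω i) ∨ ∀ i, ω i ≤ a)
    {k n : ℕ} (hk : k ≤ n) : |walk k ω| ≤ |walk n ω| + n * |a| := by
  obtain ⟨m, rfl⟩ := Nat.exists_eq_add_of_le hk
  have hka : |(k : ℤ) * a| = k * |a| := by rw [abs_mul, Nat.abs_cast]
  have hma : |(m : ℤ) * a| = m * |a| := by rw [abs_mul, Nat.abs_cast]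
  have h0 : 0 ≤ (k : ℤ) * |a| := by positivity
  have h1 : 0 ≤ (m : ℤ) * |a| := by positivity
  have h2 : ((k + m : ℕ) : ℤ) * |a| = k * |a| + m * |a| := by push_cast; ring
  have hz := walk_add k m ω
  have b1 := neg_abs_le ((k : ℤ) * a)
  have b2 := le_abs_self ((k : ℤ) * a)
  have b3 := neg_abs_le ((m : ℤ) * a)
  have b4 := le_abs_self ((m : ℤ) * a)
  have b5 := neg_abs_le (walk (k + m) ω)
  have b6 := le_abs_self (walk (k + m) ω)
  rw [h2, abs_le]
  rcases h with h | h
  · have c1 := mul_le_walk h k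
    have c2 := mul_le_walk (fun i => h (k + i)) m
    constructor <;> linarith
  · have c1 := walk_le_mul h k
    have c2 := walk_le_mul (fun i => h (k + i)) m
    constructor <;> linarith

/-- `2 |z| ≤ n + z² / n`. -/
theorem two_mul_abs_le_add_sq_div {n : ℝ} (hn : 0 < n) (z : ℝ) : 2 * |z| ≤ n + z ^ 2 / n := by
  have h : n + z ^ 2 / n - 2 * |z| = (n - |z|) ^ 2 / n := by
    field_simp; rw [sub_sq, sq_abs]; ring
  have h2 : 0 ≤ (n - |z|) ^ 2 / n := by positivity
  linarith

theorem bridgeMaxBoundWith_of_bounded_side (p : PMF ℤ) (α : WithBot ℤ) (β : WithTop ℤ) (a : ℤ)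
    (h : (∀ x, 0 < p x → a ≤ x) ∨ ∀ x, 0 < p x → x ≤ a) :
    BridgeMaxBoundWith p α β (fun _ => 1) (fun b => b / (1 + b + |(a : ℝ)|)) := by
  refine ⟨fun b hb => ⟨one_pos, by positivity⟩, fun n hn z _ b hb => bridgeMaxMoment_le ?_⟩
  rw [one_mul]
  have hn' : (0 : ℝ) < n := by exact_mod_cast hn
  have key : ∀ᵐ ω ∂(stepsLaw p), ω ∈ {ω | walk n ω = z} →
      ENNReal.ofReal (Real.exp (b / (1 + b + |(a : ℝ)|) * (maxAbsWalk n ω : ℝ))) ≤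
        ENNReal.ofReal (Real.exp (b * (n + (z : ℝ) ^ 2 / n))) := by
    filter_upwards [ae_steps_pos p] with ω hω hz
    have hz : walk n ω = z := hz
    have hside : (∀ i, a ≤ ω i) ∨ ∀ i, ω i ≤ a :=
      h.imp (fun h i => h _ (hω i)) (fun h i => h _ (hω i))
    have hmax : (maxAbsWalk n ω : ℝ) ≤ |(z : ℝ)| + n * |(a : ℝ)| := by
      rw [maxAbsWalk_le_iff _ _ (by positivity)]
      intro k hk
      have := abs_walk_le_of_bounded_side hside (Finset.mem_Icc.1 hk).2
      rw [hz] at this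
      exact_mod_cast this
    have hq := two_mul_abs_le_add_sq_div hn' z
    have hq2 : 0 ≤ (z : ℝ) ^ 2 / n := by positivity
    refine ENNReal.ofReal_le_ofReal (Real.exp_le_exp.2 ?_)
    refine (mul_le_mul_of_nonneg_left hmax (by positivity)).trans ?_
    rw [div_mul_eq_mul_div, div_le_iff₀ (by positivity), mul_assoc]
    gcongr
    set q := (z : ℝ) ^ 2 / n
    have e1 : 0 ≤ (n + q) * b := by positivity
    have e2 : 0 ≤ q * |(a : ℝ)| := by positivity
    linarith [abs_nonneg (z : ℝ)]
  calc _ ≤ ∫⁻ ω in {ω | walk n ω = z}, ENNReal.ofReal (Real.exp (b * (n + (z : ℝ) ^ 2 / n)))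
        ∂(stepsLaw p) := setLIntegral_mono_ae' (measurable_walk n (measurableSet_singleton z)) key
    _ = _ := by rw [setLIntegral_const, mul_comm, walkProb]

/-! ### Tails of unimodal functions -/

theorem Unimodal.exists_monotoneOn_antitoneOn {f : ℤ → ℝ≥0∞} (hf : Unimodal f) :
    ∃ M, (∀ x y, x ≤ y → y ≤ M → f x ≤ f y) ∧ ∀ x y, M ≤ x → x ≤ y → f y ≤ f x := by
  obtain ⟨M, h1, h2⟩ := hf
  refine ⟨M, fun x y hxy hy => ?_, fun x y hx hxy => ?_⟩
  · induction x, hxy using Int.leInductionDown with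
    | base => rfl
    | pred k hk ih => exact (h1 k (hk.trans hy)).trans ih
  · induction y, hxy using Int.leInduction with
    | base => rfl
    | succ k hk ih => exact (h2 k (hx.trans hk)).trans ih

theorem Unimodal.min_le {f : ℤ → ℝ≥0∞} (hf : Unimodal f) {x c y : ℤ} (hx : x ≤ c) (hy : c ≤ y) :
    min (f x) (f y) ≤ f c := by
  obtain ⟨M, h1, h2⟩ := hf.exists_monotoneOn_antitoneOn
  rcases le_total c M with h | h
  · exact min_le_of_left_le (h1 x c hx h)
  · exact min_le_of_right_le (h2 c y h hy)

theorem Unimodal.comp_neg {f : ℤ → ℝ≥0∞} (hf : Unimodal f) : Unimodal fun x => f (-x) := by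
  obtain ⟨M, h1, h2⟩ := hf
  refine ⟨-M, fun n hn => ?_, fun n hn => ?_⟩
  · simpa [neg_sub, sub_eq_add_neg, add_comm] using h2 (-n) (by omega)
  · simpa [sub_eq_add_neg, add_comm] using h1 (-n) (by omega)

/-- A unimodal subprobability mass function which is at least `δ` at `c` has its mode at
distance at most `1 / δ` from `c`, hence is nonincreasing to the right of `c + 1 / δ`. -/
theorem Unimodal.apply_le_of_add_inv_le {f : ℤ → ℝ≥0∞} (hf : Unimodal f) (hsum : ∑' x, f x ≤ 1)
    {δ : ℝ} (hδ : 0 < δ) {c x y : ℤ} (hc : ENNReal.ofReal δ ≤ f c) (hx : (c : ℝ) + δ⁻¹ ≤ x)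
    (hxy : x ≤ y) : f y ≤ f x := by
  by_contra! hlt
  -- If `f` increases somewhere right of `x`, unimodality gives `δ ≤ f` on all of `[c, x]`.
  have hcx : ∀ w ∈ Finset.Icc c x, ENNReal.ofReal δ ≤ f w := by
    intro w hw
    rw [Finset.mem_Icc] at hw
    obtain ⟨M, h1, h2⟩ := hf.exists_monotoneOn_antitoneOn
    have hM : x ≤ M := by
      by_contra! h
      exact absurd (h2 x y h.le hxy) hlt.not_ge
    exact hc.trans (h1 c w hw.1 (hw.2.trans hM))
  have hcx' : c ≤ x := by
    have : (c : ℝ) ≤ x := by linarith [inv_pos.2 hδ]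
    exact_mod_cast this
  have h1 := (Finset.card_nsmul_le_sum _ _ _ hcx).trans ((ENNReal.sum_le_tsum _).trans hsum)
  rw [nsmul_eq_mul, ← ENNReal.ofReal_natCast, ← ENNReal.ofReal_mul (by positivity),
    ENNReal.ofReal_le_one] at h1
  have h2 : ((Finset.Icc c x).card : ℝ) = x + 1 - c := by
    rw [Int.card_Icc, ← Int.cast_natCast, Int.toNat_of_nonneg (by omega)]; push_cast; ring
  rw [h2] at h1
  have h3 : (1 : ℝ) < (x + 1 - c) * δ := by
    rw [← div_lt_iff₀ hδ, one_div]; linarith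
  linarith

/-- If the product `f y * g (z - y)` is dominated by the constant `h`, the value of `g` at `c'`
gives a bound on `f` to the right of `z - c'`. -/
theorem Unimodal.tail_le {f g : ℤ → ℝ≥0∞} (hf : Unimodal f) (hsum : ∑' x, f x ≤ 1)
    {δ : ℝ} (hδ : 0 < δ) {c c' z : ℤ} (hc : ENNReal.ofReal δ ≤ f c)
    (hc' : ENNReal.ofReal δ ≤ g c') {h : ℝ≥0∞} (hfg : ∀ y, f y * g (z - y) ≤ h)
    (hz : (c : ℝ) + δ⁻¹ ≤ z - c') {y : ℤ} (hy : z - c' ≤ y) :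
    f y ≤ h * ENNReal.ofReal δ⁻¹ := by
  have h1 : f y ≤ f (z - c') :=
    hf.apply_le_of_add_inv_le hsum hδ hc (by push_cast; exact hz) hy
  have h2 := hfg (z - c')
  rw [sub_sub_cancel] at h2
  have h3 : f y * ENNReal.ofReal δ ≤ h := (mul_le_mul' h1 hc').trans h2
  rw [ENNReal.ofReal_inv_of_pos hδ, ← div_eq_mul_inv,
    ENNReal.le_div_iff_mul_le (by simp [hδ]) (by simp)]
  exact h3

/-- For an endpoint `z` far from both modes, at every `y` at least one of the factors
`f y`, `g (z - y)` is small, unless `y` is of the order of `z`. -/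
theorem small_factor_or_abs_le {f g : ℤ → ℝ≥0∞} (hf : Unimodal f) (hg : Unimodal g)
    (hfsum : ∑' x, f x ≤ 1) (hgsum : ∑' x, g x ≤ 1) {δ A : ℝ} (hδ : 0 < δ) {c c' z : ℤ}
    (hc : ENNReal.ofReal δ ≤ f c) (hc' : ENNReal.ofReal δ ≤ g c')
    (hcA : |(c : ℝ)| ≤ A) (hcA' : |(c' : ℝ)| ≤ A) {h : ℝ≥0∞} (hfg : ∀ y, f y * g (z - y) ≤ h)
    (hz : 2 * A + δ⁻¹ ≤ |(z : ℝ)|) (y : ℤ) :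
    f y ≤ h * ENNReal.ofReal δ⁻¹ ∨ g (z - y) ≤ h * ENNReal.ofReal δ⁻¹ ∨
      |(y : ℝ)| ≤ |(z : ℝ)| + A := by
  wlog hz0 : 0 ≤ (z : ℝ) generalizing f g c c' z y
  · have key := this (f := fun x => f (-x)) (g := fun x => g (-x)) hf.comp_neg hg.comp_neg
      ((Equiv.neg ℤ).tsum_eq f |>.trans_le hfsum) ((Equiv.neg ℤ).tsum_eq g |>.trans_le hgsum)
      (c := -c) (c' := -c') (z := -z) (by simpa using hc) (by simpa using hc') (by simpa using hcA)
      (by simpa using hcA') (fun y => by simpa [add_comm, sub_eq_add_neg] using hfg (-y))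
      (by simpa using hz) (-y) (by push_cast; linarith)
    simpa [add_comm, sub_eq_add_neg] using key
  rw [abs_of_nonneg hz0] at hz ⊢
  rw [abs_le] at hcA hcA'
  by_cases h1 : z - c' ≤ y
  · exact .inl (hf.tail_le hfsum hδ hc hc' hfg (by linarith) h1)
  by_cases h2 : z - c ≤ z - y
  · refine .inr (.inl (hg.tail_le hgsum hδ hc' hc (fun x => ?_) (by linarith) h2))
    simpa [mul_comm] using hfg (z - x)
  refine .inr (.inr (abs_le.2 ?_))
  have h1' : (y : ℝ) < z - c' := by push Not at h1; exact_mod_cast h1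
  have h2' : (c : ℝ) < y := by push Not at h2; exact_mod_cast (by omega : c < y)
  constructor <;> linarith

/-- The exponential moment of the intermediate position of a bridge, in terms of the mass
functions `f`, `g` of the two pieces and of their convolution. -/
theorem tsum_exp_mul_le {f g : ℤ → ℝ≥0∞} {l B : ℝ} (hl : 0 ≤ l) {D K : ℝ≥0∞} {z : ℤ}
    (hfK : ∑' y : ℤ, ENNReal.ofReal (Real.exp (l * |(y : ℝ)|)) * f y ≤ K)
    (hgK : ∑' y : ℤ, ENNReal.ofReal (Real.exp (l * |(y : ℝ)|)) * g y ≤ K)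
    (hsmall : ∀ y : ℤ, f y ≤ D ∨ g (z - y) ≤ D ∨ |(y : ℝ)| ≤ B) :
    ∑' y : ℤ, ENNReal.ofReal (Real.exp (l * |(y : ℝ)|)) * (f y * g (z - y)) ≤
      ENNReal.ofReal (Real.exp (l * B)) * ∑' y, f y * g (z - y) +
        ENNReal.ofReal (Real.exp (l * |(z : ℝ)|)) * D * K + D * K := by
  set e : ℤ → ℝ≥0∞ := fun y => ENNReal.ofReal (Real.exp (l * |(y : ℝ)|)) with he
  have htri (y : ℤ) : e y ≤ e z * e (z - y) := by
    simp only [he]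
    rw [← ENNReal.ofReal_mul (Real.exp_pos _).le, ← Real.exp_add, ← mul_add]
    gcongr
    have := abs_sub_abs_le_abs_sub (y : ℝ) z
    rw [abs_sub_comm] at this
    push_cast
    linarith
  have hterm (y : ℤ) : e y * (f y * g (z - y)) ≤
      ENNReal.ofReal (Real.exp (l * B)) * (f y * g (z - y)) +
        e z * D * (e (z - y) * g (z - y)) + D * (e y * f y) := by
    rcases hsmall y with h | h | h
    · refine le_add_right (le_add_left ?_)
      calc e y * (f y * g (z - y)) ≤ (e z * e (z - y)) * (D * g (z - y)) := by
            gcongr; exact htri y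
        _ = _ := by ring
    · refine le_add_left ?_
      calc e y * (f y * g (z - y)) ≤ e y * (f y * D) := by gcongr
        _ = _ := by ring
    · refine le_add_right (le_add_right ?_)
      gcongr
      exact ENNReal.ofReal_le_ofReal (Real.exp_le_exp.2 (by gcongr))
  refine (ENNReal.tsum_le_tsum hterm).trans ?_
  rw [ENNReal.tsum_add, ENNReal.tsum_add, ENNReal.tsum_mul_left, ENNReal.tsum_mul_left,
    ENNReal.tsum_mul_left]
  have hshift : ∑' y, e (z - y) * g (z - y) = ∑' y, e y * g y :=
    (Equiv.subLeft z).tsum_eq fun y => e y * g y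
  rw [hshift]
  gcongr

/-! ### The bridge maximum for strongly unimodal steps -/

section Bridge

variable {p : PMF ℤ} {l Δ R C c Chat chat : ℝ}

theorem AdmissibleConstants.delta_le_one (h : AdmissibleConstants p l Δ R C c Chat chat) :
    Δ ≤ 1 := by
  have h1 := h.mean_lower 1 le_rfl
  have h2 : walkMass p 1 ⌊mean p * (1 : ℕ)⌋ ≤ 1 := measureReal_le_one
  simpa using h1.trans h2

/-- The lower bound near the mean, uniformly over all times `m ≤ n` including `m = 0`. -/
theorem AdmissibleConstants.le_walkProb_floor (h : AdmissibleConstants p l Δ R C c Chat chat)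
    {m n : ℕ} (hn : 1 ≤ n) (hmn : m ≤ n) :
    ENNReal.ofReal (Δ / √n) ≤ walkProb p m ⌊mean p * m⌋ := by
  have hn' : (1 : ℝ) ≤ n := by exact_mod_cast hn
  rcases Nat.eq_zero_or_pos m with rfl | hm
  · have : walkProb p 0 ⌊mean p * (0 : ℕ)⌋ = 1 := by simp [walkProb_zero]
    rw [this, ENNReal.ofReal_le_one, div_le_one (by positivity)]
    exact h.delta_le_one.trans (Real.one_le_sqrt.2 hn')
  · rw [← ofReal_walkMass]
    refine ENNReal.ofReal_le_ofReal (le_trans ?_ (h.mean_lower m hm))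
    have := h.Δ_pos
    gcongr

theorem abs_floor_mul_le (μ : ℝ) {m n : ℕ} (hmn : m ≤ n) : |(⌊μ * m⌋ : ℝ)| ≤ |μ| * n + 1 := by
  have h1 := Int.floor_le (μ * m)
  have h2 := Int.lt_floor_add_one (μ * m)
  have h3 : |μ * m| ≤ |μ| * n := by
    rw [abs_mul, Nat.abs_cast]; gcongr
  rw [abs_le] at h3 ⊢
  constructor <;> linarith

/-- The estimate for endpoints `|z| ≤ 2Rn`, where the crude bound `max |S_k| ≤ ∑ |X_i|` and the
exponential lower bound on `P(S_n = z)` suffice. -/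
theorem AdmissibleConstants.setLIntegral_le_of_abs_le
    (h : AdmissibleConstants p l Δ R C c Chat chat) (hl : 0 < l) (hfin : absMGF p l < ∞)
    {n : ℕ} (hn : 1 ≤ n) {z : ℤ} (hz : |(z : ℝ)| ≤ 2 * R * n) :
    ∫⁻ ω in {ω | walk n ω = z}, ENNReal.ofReal (Real.exp (l * (maxAbsWalk n ω : ℝ)))
      ∂(stepsLaw p) ≤ walkProb p n z * ENNReal.ofReal (Chat * Real.exp (chat * n)) := by
  have hn' : (1 : ℝ) ≤ n := by exact_mod_cast hn
  have hΔ := h.Δ_pos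
  have hC := h.C_pos
  have hsqrt : 0 < √(n : ℝ) := by positivity
  calc _ ≤ ∫⁻ ω, ENNReal.ofReal (Real.exp (l * (maxAbsWalk n ω : ℝ))) ∂(stepsLaw p) :=
        setLIntegral_le_lintegral _ _
    _ ≤ absMGF p l ^ n := by
      rw [← lintegral_exp_sum_abs]
      refine lintegral_mono fun ω => ENNReal.ofReal_le_ofReal (Real.exp_le_exp.2 ?_)
      gcongr
      rw [maxAbsWalk_le_iff _ _ (Finset.sum_nonneg fun _ _ => abs_nonneg _)]
      exact fun k hk => abs_walk_le (Finset.mem_Icc.1 hk).2 ω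
    _ = ENNReal.ofReal ((absMGF p l).toReal ^ n) := by
      rw [ENNReal.ofReal_pow ENNReal.toReal_nonneg, ENNReal.ofReal_toReal hfin.ne]
    _ = ENNReal.ofReal (C / √n * Real.exp (-c * n)) *
        ENNReal.ofReal ((absMGF p l).toReal ^ n * (C⁻¹ * √n * Real.exp (c * n))) := by
      rw [← ENNReal.ofReal_mul (by positivity)]
      congr 1
      rw [neg_mul, Real.exp_neg]
      have := Real.exp_pos (c * n)
      field_simp
    _ ≤ walkProb p n z * ENNReal.ofReal (Chat * Real.exp (chat * n)) := by
      rw [← ofReal_walkMass]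
      refine mul_le_mul' (ENNReal.ofReal_le_ofReal (h.lower n hn z hz))
        (ENNReal.ofReal_le_ofReal (le_trans ?_ (h.upper n hn)))
      · gcongr
        exact le_add_of_nonneg_left (by positivity)

/-- The estimate for endpoints `|z| > 2Rn`: the maximum is bounded by the sum over `k`, and for
each `k` either the position `S_k` is at most of the order of `z`, or unimodality bounds one of the
two factors of `P(S_k = y) P(S_{n-k} = z - y)` by a multiple of `P(S_n = z)`. -/
theorem AdmissibleConstants.setLIntegral_le_of_lt_abs (hp : StronglyUnimodal p)
    (h : AdmissibleConstants p l Δ R C c Chat chat) (hl : 0 < l) (hfin : absMGF p l < ∞)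
    {n : ℕ} (hn : 1 ≤ n) {z : ℤ} (hz : 2 * R * n < |(z : ℝ)|) :
    ∫⁻ ω in {ω | walk n ω = z}, ENNReal.ofReal (Real.exp (l * (maxAbsWalk n ω : ℝ)))
      ∂(stepsLaw p) ≤ walkProb p n z *
        ENNReal.ofReal (Chat * Real.exp (chat * n) * Real.exp (l * (3 / 2 * |(z : ℝ)|))) := by
  have hn' : (1 : ℝ) ≤ n := by exact_mod_cast hn
  have hΔ := h.Δ_pos
  have hC := h.C_pos
  have hsqrt1 : 1 ≤ √(n : ℝ) := Real.one_le_sqrt.2 hn'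
  have hsqrtn : √(n : ℝ) ≤ n := by
    rw [Real.sqrt_le_left (by positivity)]; nlinarith
  set μ := mean p with hμ
  have hRn : (|μ| + 1 + Δ⁻¹) * n ≤ R * n := by have := h.R_gt; gcongr
  set A : ℝ := |μ| * n + 1 with hA
  set δ : ℝ := Δ / √n with hδ
  have hδ0 : 0 < δ := by positivity
  have hδinv : δ⁻¹ = √n / Δ := by rw [hδ, inv_div]
  have hδ1 : 1 ≤ √n / Δ := by
    rw [one_le_div hΔ]; exact h.delta_le_one.trans hsqrt1
  have hδn : √n / Δ ≤ Δ⁻¹ * n := by rw [div_eq_inv_mul]; gcongr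
  have hΔn : 0 ≤ Δ⁻¹ * n := by positivity
  have hμn : 0 ≤ |μ| * n := by positivity
  have hfar : 2 * A + δ⁻¹ ≤ |(z : ℝ)| := by rw [hδinv]; linarith
  have hAz : |(z : ℝ)| + A ≤ 3 / 2 * |(z : ℝ)| := by linarith
  set E := Real.exp (l * (3 / 2 * |(z : ℝ)|)) with hE
  set K := (absMGF p l).toReal with hK
  have hM : absMGF p l = ENNReal.ofReal K := (ENNReal.ofReal_toReal hfin.ne).symm
  have hK1 : 1 ≤ K := by
    have := one_le_absMGF p hl.le
    rwa [hM, ENNReal.one_le_ofReal] at this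
  have hMn : absMGF p l ^ n = ENNReal.ofReal (K ^ n) := by
    rw [hM, ENNReal.ofReal_pow (by positivity)]
  have hmom {m : ℕ} (hm : m ≤ n) :
      ∑' y : ℤ, ENNReal.ofReal (Real.exp (l * |(y : ℝ)|)) * walkProb p m y ≤
        ENNReal.ofReal (K ^ n) := by
    rw [← hMn]
    exact (tsum_exp_mul_walkProb_le p hl.le m).trans
      (pow_le_pow_right₀ (one_le_absMGF p hl.le) hm)
  have hKn : 1 ≤ K ^ n := one_le_pow₀ hK1
  have hk (k : ℕ) (hk : k ≤ n) :
      ∫⁻ ω in {ω | walk n ω = z}, ENNReal.ofReal (Real.exp (l * |(walk k ω : ℝ)|))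
        ∂(stepsLaw p) ≤ walkProb p n z * ENNReal.ofReal (E * K ^ n * (4 * √n / Δ)) := by
    obtain ⟨m, rfl⟩ := Nat.exists_eq_add_of_le hk
    have hm : m ≤ k + m := Nat.le_add_left m k
    rw [setLIntegral_walk_eq p k m z fun y => ENNReal.ofReal (Real.exp (l * |(y : ℝ)|))]
    refine (tsum_exp_mul_le hl.le (hmom hk) (hmom hm) (z := z) (small_factor_or_abs_le
      (unimodal_walkProb hp k) (unimodal_walkProb hp m) (tsum_walkProb p k).le
      (tsum_walkProb p m).le hδ0 (h.le_walkProb_floor hn hk) (h.le_walkProb_floor hn hm)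
      (abs_floor_mul_le μ hk) (abs_floor_mul_le μ hm) (h := walkProb p (k + m) z)
      (fun y => ?_) hfar)).trans ?_
    · simpa using walkProb_mul_le p k m y (z - y)
    · rw [← walkProb_add, hδinv]
      set q := walkProb p (k + m) z
      set N : ℝ := ((k + m : ℕ) : ℝ)
      calc _ = q * ENNReal.ofReal (Real.exp (l * (|(z : ℝ)| + A)) +
            Real.exp (l * |(z : ℝ)|) * (√N / Δ) * K ^ (k + m) + √N / Δ * K ^ (k + m)) := by
            rw [ENNReal.ofReal_add (by positivity) (by positivity),
              ENNReal.ofReal_add (by positivity) (by positivity),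
              ENNReal.ofReal_mul (by positivity), ENNReal.ofReal_mul (by positivity),
              ENNReal.ofReal_mul (p := √N / Δ) (by positivity)]
            ring
        _ ≤ _ := by
          gcongr q * ENNReal.ofReal ?_
          have e1 : Real.exp (l * (|(z : ℝ)| + A)) ≤ E := Real.exp_le_exp.2 (by gcongr)
          have e2 : Real.exp (l * |(z : ℝ)|) ≤ E :=
            Real.exp_le_exp.2 (by gcongr; linarith [abs_nonneg (z : ℝ)])
          have e3 : 1 ≤ E := Real.one_le_exp (by positivity)
          set r := √N / Δ
          have e4 : 4 * √N / Δ = r + r + r + r := by simp only [r]; ring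
          rw [e4]
          have f1 : E ≤ E * K ^ (k + m) * r := by
            rw [mul_assoc]
            exact le_mul_of_one_le_right (by positivity) (one_le_mul_of_one_le_of_one_le hKn hδ1)
          have f2 : Real.exp (l * |(z : ℝ)|) * r * K ^ (k + m) ≤ E * K ^ (k + m) * r := by
            rw [mul_right_comm]; gcongr
          have f3 : r * K ^ (k + m) ≤ E * K ^ (k + m) * r := by
            rw [mul_comm r, mul_assoc]
            exact le_mul_of_one_le_left (by positivity) e3
          have f4 : 0 ≤ E * K ^ (k + m) * r := by positivity
          linarith
  calc _ ≤ ∫⁻ ω in {ω | walk n ω = z}, ∑ k ∈ Finset.Icc 1 n,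
          ENNReal.ofReal (Real.exp (l * |(walk k ω : ℝ)|)) ∂(stepsLaw p) :=
        lintegral_mono fun ω => exp_maxAbsWalk_le_sum l hn ω
    _ = ∑ k ∈ Finset.Icc 1 n, ∫⁻ ω in {ω | walk n ω = z},
          ENNReal.ofReal (Real.exp (l * |(walk k ω : ℝ)|)) ∂(stepsLaw p) :=
        lintegral_finsetSum _ fun k _ =>
          (measurable_of_countable fun y : ℤ => ENNReal.ofReal (Real.exp (l * |(y : ℝ)|))).comp
            (measurable_walk k)
    _ ≤ ∑ k ∈ Finset.Icc 1 n, walkProb p n z * ENNReal.ofReal (E * K ^ n * (4 * √n / Δ)) :=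
        Finset.sum_le_sum fun k hk' => hk k (Finset.mem_Icc.1 hk').2
    _ = walkProb p n z * ENNReal.ofReal (K ^ n * (4 * (n : ℝ) ^ (3 / 2 : ℝ) / Δ) * E) := by
        have hpow : (n : ℝ) ^ (3 / 2 : ℝ) = n * √n := by
          rw [Real.sqrt_eq_rpow, ← Real.rpow_one_add' (by positivity) (by norm_num)]
          norm_num
        rw [Finset.sum_const, Nat.card_Icc, Nat.add_sub_cancel, nsmul_eq_mul, hpow,
          ← ENNReal.ofReal_natCast, mul_left_comm, ← ENNReal.ofReal_mul (by positivity)]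
        congr 2
        ring
    _ ≤ _ := by
        refine mul_le_mul_right (ENNReal.ofReal_le_ofReal
          (mul_le_mul_of_nonneg_right (le_trans ?_ (h.upper n hn)) (by positivity))) _
        gcongr
        exact le_add_of_nonneg_right (by positivity)

theorem lintegral_exp_div_le {Ω : Type*} [MeasurableSpace Ω] (P : Measure Ω)
    [IsProbabilityMeasure P] {X : Ω → ℝ} (hX : Measurable X) (l : ℝ) {v : ℕ} (hv : 1 ≤ v) :
    ∫⁻ ω, ENNReal.ofReal (Real.exp (l / v * X ω)) ∂P ≤
      (∫⁻ ω, ENNReal.ofReal (Real.exp (l * X ω)) ∂P) ^ (1 / (v : ℝ)) := by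
  have hv' : (1 : ℝ) ≤ v := by exact_mod_cast hv
  have h := eLpNorm'_le_eLpNorm'_of_exponent_le (μ := P) one_pos hv'
    (f := fun ω => Real.exp (l / v * X ω)) (by fun_prop)
  simp only [eLpNorm', Real.enorm_eq_ofReal (Real.exp_pos _).le, ENNReal.rpow_one, one_div,
    inv_one] at h
  rw [one_div]
  convert! h using 4 with ω
  rw [ENNReal.ofReal_rpow_of_pos (Real.exp_pos _), ← Real.exp_mul]
  congr 2
  field_simp

/-- Jensen's inequality for the bridge: passing from the exponent `l` to `l / v` takes the `v`-th
root of the bound. -/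
theorem bridgeMaxMoment_div_le {n : ℕ} {z : ℤ} {B : ℝ≥0∞} {v : ℕ} (hv : 1 ≤ v)
    (h : bridgeMaxMoment p l n z ≤ B) :
    bridgeMaxMoment p (l / v) n z ≤ B ^ (1 / (v : ℝ)) := by
  by_cases h0 : stepsLaw p {ω | walk n ω = z} = 0
  · rw [bridgeMaxMoment, cond_eq_zero_of_meas_eq_zero h0]
    simp
  · have := cond_isProbabilityMeasure h0
    exact (lintegral_exp_div_le _ (X := fun ω => (maxAbsWalk n ω : ℝ))
      ((measurable_of_countable _).comp (measurable_maxAbsWalk n)) l hv).trans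
      (ENNReal.rpow_le_rpow h (by positivity))

theorem bridgeMaxBoundWith_of_stronglyUnimodal (α : WithBot ℤ) (β : WithTop ℤ)
    (hp : StronglyUnimodal p) (h : AdmissibleConstants p l Δ R C c Chat chat) (hl : 0 < l)
    (hfin : absMGF p l < ∞) (v : ℝ → ℕ)
    (hv : ∀ b : ℝ, 0 < b → 1 ≤ v b ∧ chat / (v b : ℝ) ≤ b / 2 ∧ l / (v b : ℝ) ≤ b / 2) :
    BridgeMaxBoundWith p α β (fun b => Chat ^ (1 / (v b : ℝ))) (fun b => l / (v b : ℝ)) := by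
  have hChat := h.Chat_pos
  refine ⟨fun b hb => ?_, fun n hn z _ b hb => ?_⟩
  · have : (0 : ℝ) < v b := by exact_mod_cast (hv b hb).1
    exact ⟨by positivity, by positivity⟩
  obtain ⟨hv1, hv2, hv3⟩ := hv b hb
  have hn' : (0 : ℝ) < n := by exact_mod_cast hn
  have hmain : bridgeMaxMoment p l n z ≤
      ENNReal.ofReal (Chat * Real.exp (chat * n) * Real.exp (l * (3 / 2 * |(z : ℝ)|))) := by
    refine bridgeMaxMoment_le ?_
    rcases le_or_gt |(z : ℝ)| (2 * R * n) with hz | hz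
    · refine (h.setLIntegral_le_of_abs_le hl hfin hn hz).trans ?_
      exact mul_le_mul_right (ENNReal.ofReal_le_ofReal
        (le_mul_of_one_le_right (by positivity) (Real.one_le_exp (by positivity)))) _
    · exact h.setLIntegral_le_of_lt_abs hp hl hfin hn hz
  refine (bridgeMaxMoment_div_le hv1 hmain).trans ?_
  rw [ENNReal.ofReal_rpow_of_pos (by positivity), mul_assoc, ← Real.exp_add,
    Real.mul_rpow hChat.le (Real.exp_pos _).le, ← Real.exp_mul]
  refine ENNReal.ofReal_le_ofReal
    (mul_le_mul_of_nonneg_left (Real.exp_le_exp.2 ?_) (by positivity))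
  have hq := two_mul_abs_le_add_sq_div hn' z
  have hq2 : 0 ≤ (z : ℝ) ^ 2 / n := by positivity
  calc (chat * n + l * (3 / 2 * |(z : ℝ)|)) * (1 / (v b : ℝ))
      = chat / v b * n + l / v b * (3 / 2 * |(z : ℝ)|) := by ring
    _ ≤ b / 2 * n + b / 2 * (3 / 2 * |(z : ℝ)|) := by gcongr
    _ ≤ b / 2 * n + b / 2 * (n + 2 * ((z : ℝ) ^ 2 / n)) := by
      gcongr; linarith
    _ = b * (n + (z : ℝ) ^ 2 / n) := by ring

end Bridge

/-! ### Existence of admissible constants -/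

section Existence

variable {p : PMF ℤ} {l : ℝ}

theorem memLp_step (hl : 0 < l) (hfin : absMGF p l < ∞) :
    MemLp (fun x : ℤ => (x : ℝ)) 2 p.toMeasure := by
  rw [memLp_two_iff_integrable_sq (measurable_of_countable _).aestronglyMeasurable]
  have hint : Integrable (fun x : ℤ => Real.exp (l * |(x : ℝ)|)) p.toMeasure :=
    (lintegral_ofReal_ne_top_iff_integrable (measurable_of_countable _).aestronglyMeasurable
      (ae_of_all _ fun _ => (Real.exp_pos _).le)).1 hfin.ne
  refine (hint.const_mul (2 / l ^ 2)).mono'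
    (measurable_of_countable _).aestronglyMeasurable (ae_of_all _ fun x => ?_)
  have h := Real.quadratic_le_exp_of_nonneg (x := l * |(x : ℝ)|) (by positivity)
  have h2 : 0 ≤ l * |(x : ℝ)| := by positivity
  rw [Real.norm_of_nonneg (by positivity), div_mul_eq_mul_div, le_div_iff₀ (by positivity)]
  rw [mul_pow, sq_abs] at h
  linarith

theorem identDistrib_step (p : PMF ℤ) (i : ℕ) :
    IdentDistrib (fun ω : ℕ → ℤ => (ω i : ℝ)) (fun x : ℤ => (x : ℝ)) (stepsLaw p)
      p.toMeasure := by
  have hi : Measurable fun ω : ℕ → ℤ => ω i := measurable_pi_apply i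
  have h : IdentDistrib (fun ω : ℕ → ℤ => ω i) (fun x : ℤ => x) (stepsLaw p) p.toMeasure :=
    ⟨hi.aemeasurable, aemeasurable_id, (map_step p i).trans Measure.map_id.symm⟩
  exact h.comp (measurable_of_countable fun x : ℤ => (x : ℝ))

theorem variance_step_ne_zero (hfull : ∀ x, 0 < p x) (hl : 0 < l) (hfin : absMGF p l < ∞) :
    Var[fun x : ℤ => (x : ℝ); p.toMeasure] ≠ 0 := by
  intro h
  have h1 := ae_eq_integral_of_variance_eq_zero (memLp_step hl hfin) h
  rw [ae_iff_of_countable] at h1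
  have h2 (x : ℤ) := h1 x (by
    rw [PMF.toMeasure_apply_singleton _ _ (measurableSet_singleton _)]; exact (hfull x).ne')
  have h3 := (h2 0).trans (h2 1).symm
  norm_num at h3

/-- By the central limit theorem, the rescaled walk charges every nonempty open set with
probability bounded away from zero. -/
theorem eventually_lt_measure_rescaled_walk (hfull : ∀ x, 0 < p x) (hl : 0 < l)
    (hfin : absMGF p l < ∞) {G : Set ℝ} (hG : IsOpen G) (hne : G.Nonempty) :
    ∃ ε : ℝ, 0 < ε ∧ ∀ᶠ n : ℕ in Filter.atTop, ENNReal.ofReal ε <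
      stepsLaw p {ω | (√n)⁻¹ * ((walk n ω : ℝ) - n * mean p) ∈ G} := by
  have hid := identDistrib_step p
  have hvar : Var[fun ω : ℕ → ℤ => (ω 0 : ℝ); stepsLaw p].toNNReal ≠ 0 := by
    rw [(hid 0).variance_eq]
    have h := variance_step_ne_zero hfull hl hfin
    have h0 := variance_nonneg (fun x : ℤ => (x : ℝ)) p.toMeasure
    exact (Real.toNNReal_pos.2 (lt_of_le_of_ne h0 h.symm)).ne'
  have hclt := (tendstoInDistribution_inv_sqrt_mul_sum_sub (P := stepsLaw p)
    (X := fun i ω => (ω i : ℝ)) (Y := id)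
    (P' := gaussianReal 0 Var[fun ω : ℕ → ℤ => (ω 0 : ℝ); stepsLaw p].toNNReal)
    HasLaw.id ((hid 0).memLp_iff.2 (memLp_step hl hfin))
    ((iIndepFun_steps p).comp (fun _ x => (x : ℝ)) fun _ => measurable_of_countable _)
    (fun i => (hid i).trans (hid 0).symm)).tendsto
  have hlim := ProbabilityMeasure.le_liminf_measure_open_of_tendsto hclt hG
  have hpos : gaussianReal 0 Var[fun ω : ℕ → ℤ => (ω 0 : ℝ); stepsLaw p].toNNReal G ≠ 0 :=
    fun h => (hG.measure_pos volume hne).ne' (gaussianReal_absolutelyContinuous' 0 hvar h)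
  simp only [ProbabilityMeasure.coe_mk, Measure.map_id] at hlim
  obtain ⟨ε, hε0, hε⟩ := ENNReal.lt_iff_exists_real_btwn.1 (pos_iff_ne_zero.2 hpos)
  refine ⟨ε, ENNReal.ofReal_pos.1 hε.1, ?_⟩
  filter_upwards [Filter.eventually_lt_of_lt_liminf (hε.2.trans_le hlim)] with n hn
  rw [Measure.map_apply (by fun_prop) hG.measurableSet, (hid 0).integral_eq] at hn
  convert hn using 2
  ext ω
  simp [walk, mean]

/-- If the walk falls into an interval of length `√n` with probability more than `ε`, some integer
of that interval carries mass at least of order `ε / √n`. -/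
theorem exists_le_walkProb {n : ℕ} (hn : 1 ≤ n) {ε r : ℝ} (hε : 0 < ε)
    (h : ENNReal.ofReal ε < stepsLaw p {ω | r < walk n ω ∧ (walk n ω : ℝ) < r + √n}) :
    ∃ y : ℤ, r < y ∧ (y : ℝ) < r + √n ∧ ENNReal.ofReal (ε / (2 * √n)) ≤ walkProb p n y := by
  by_contra! hcon
  have hsqrt : 1 ≤ √(n : ℝ) := Real.one_le_sqrt.2 (by exact_mod_cast hn)
  set s := (Finset.Icc ⌈r⌉ ⌊r + √n⌋).filter fun y : ℤ => r < y ∧ (y : ℝ) < r + √n with hs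
  have hcard : (s.card : ℝ) ≤ 2 * √n := by
    have h1 : (s.card : ℝ) ≤ ((Finset.Icc ⌈r⌉ ⌊r + √n⌋).card : ℝ) := by
      exact_mod_cast Finset.card_filter_le _ _
    have h2 : ((Finset.Icc ⌈r⌉ ⌊r + √n⌋).card : ℝ) ≤ √n + 1 := by
      have h3 : ((Finset.Icc ⌈r⌉ ⌊r + √n⌋).card : ℤ) = max (⌊r + √n⌋ + 1 - ⌈r⌉) 0 := by
        rw [Int.card_Icc, Int.toNat_eq_max]
      have h4 : (((Finset.Icc ⌈r⌉ ⌊r + √n⌋).card : ℤ) : ℝ) ≤ √n + 1 := by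
        rw [h3]
        push_cast
        refine max_le ?_ (by positivity)
        linarith [Int.floor_le (r + √n), Int.le_ceil r]
      exact_mod_cast h4
    linarith
  have hle : stepsLaw p {ω | r < walk n ω ∧ (walk n ω : ℝ) < r + √n} ≤
      ∑ y ∈ s, walkProb p n y := by
    refine (measure_mono fun ω hω => ?_).trans (measure_biUnion_finset_le s _)
    simp only [Set.mem_iUnion]
    refine ⟨walk n ω, ?_, rfl⟩
    rw [hs, Finset.mem_filter, Finset.mem_Icc]
    exact ⟨⟨Int.ceil_le.2 hω.1.le, Int.le_floor.2 hω.2.le⟩, hω⟩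
  have hsum : ∑ y ∈ s, walkProb p n y ≤ ENNReal.ofReal ε := by
    calc _ ≤ ∑ _y ∈ s, ENNReal.ofReal (ε / (2 * √n)) := by
          refine Finset.sum_le_sum fun y hy => ?_
          obtain ⟨-, h1, h2⟩ := Finset.mem_filter.1 hy
          exact (hcon y h1 h2).le
      _ = ENNReal.ofReal (s.card * (ε / (2 * √n))) := by
          rw [Finset.sum_const, nsmul_eq_mul, ENNReal.ofReal_mul (by positivity),
            ENNReal.ofReal_natCast]
      _ ≤ _ := by
          refine ENNReal.ofReal_le_ofReal ?_
          rw [mul_div_left_comm]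
          exact mul_le_of_le_one_right hε.le ((div_le_one (by positivity)).2 hcard)
  exact absurd (h.trans_le (hle.trans hsum)) (lt_irrefl _)

/-- The central limit theorem provides points on either side of `μ n` carrying mass of order
`1 / √n`, and unimodality transfers the bound to `⌊μ n⌋` between them. -/
theorem eventually_le_walkMass_floor (hfull : ∀ x, 0 < p x) (hp : StronglyUnimodal p)
    (hl : 0 < l) (hfin : absMGF p l < ∞) :
    ∃ δ : ℝ, 0 < δ ∧ ∀ᶠ n : ℕ in Filter.atTop, δ / √n ≤ walkMass p n ⌊mean p * n⌋ := by
  obtain ⟨ε₁, hε₁, h₁⟩ := eventually_lt_measure_rescaled_walk hfull hl hfin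
    (isOpen_Ioo (a := (-2 : ℝ)) (b := -1)) ⟨-3 / 2, by norm_num⟩
  obtain ⟨ε₂, hε₂, h₂⟩ := eventually_lt_measure_rescaled_walk hfull hl hfin
    (isOpen_Ioo (a := (1 : ℝ)) (b := 2)) ⟨3 / 2, by norm_num⟩
  refine ⟨min ε₁ ε₂ / 2, by positivity, ?_⟩
  filter_upwards [h₁, h₂, Filter.eventually_ge_atTop 1] with n h₁ h₂ hn
  have hn' : (1 : ℝ) ≤ n := by exact_mod_cast hn
  have hsqrt : 1 ≤ √(n : ℝ) := Real.one_le_sqrt.2 hn'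
  have hs0 : 0 < √(n : ℝ) := by positivity
  obtain ⟨x, -, hx, hxm⟩ := exists_le_walkProb (p := p) hn (r := n * mean p - 2 * √n) hε₁ (by
    convert h₁ using 4 with ω
    rw [Set.mem_Ioo, inv_mul_eq_div, lt_div_iff₀ hs0, div_lt_iff₀ hs0]
    constructor <;> rintro ⟨h, h'⟩ <;> constructor <;> linarith)
  obtain ⟨y, hy, -, hym⟩ := exists_le_walkProb (p := p) hn (r := n * mean p + √n) hε₂ (by
    convert h₂ using 4 with ω
    rw [Set.mem_Ioo, inv_mul_eq_div, lt_div_iff₀ hs0, div_lt_iff₀ hs0]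
    constructor <;> rintro ⟨h, h'⟩ <;> constructor <;> linarith)
  have hxc : x ≤ ⌊mean p * n⌋ := Int.le_floor.2 (by linarith)
  have hcy : ⌊mean p * n⌋ ≤ y := by
    have h := Int.floor_le (mean p * n)
    have : (⌊mean p * n⌋ : ℝ) ≤ y := by linarith
    exact_mod_cast this
  have hmin := (unimodal_walkProb hp n).min_le hxc hcy
  rw [← ENNReal.ofReal_le_ofReal_iff (show 0 ≤ walkMass p n _ from measureReal_nonneg),
    ofReal_walkMass]
  refine le_trans (le_min (le_trans ?_ hxm) (le_trans ?_ hym)) hmin <;>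
    refine ENNReal.ofReal_le_ofReal ?_ <;> rw [div_div] <;> gcongr
  exacts [min_le_left _ _, min_le_right _ _]

/-- A point `|z| ≤ K n` is reached by `n` steps in `[-K, K]`. -/
theorem pow_le_walkProb {K : ℕ} {m : ℝ≥0∞} (hm : ∀ x : ℤ, |x| ≤ K → m ≤ p x) (n : ℕ) {z : ℤ}
    (hz : |z| ≤ K * n) : m ^ n ≤ walkProb p n z := by
  induction n generalizing z with
  | zero =>
    have : z = 0 := by simpa using hz
    simp [this, walkProb_zero]
  | succ n ih =>
    obtain ⟨x, hx, hzx⟩ : ∃ x : ℤ, |x| ≤ K ∧ |z - x| ≤ K * n := by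
      -- The first step is the truncation of `z` to `[-K, K]`.
      refine ⟨max (-K) (min K z), ?_, ?_⟩
      · rw [abs_le]; omega
      · have : 0 ≤ (K : ℤ) * n := by positivity
        push_cast [mul_add] at hz
        rw [abs_le] at hz ⊢
        constructor <;> omega
    calc m ^ (n + 1) = m * m ^ n := pow_succ' m n
      _ ≤ walkProb p 1 x * walkProb p n (z - x) := by
        rw [walkProb_one]; exact mul_le_mul' (hm x hx) (ih hzx)
      _ ≤ walkProb p (n + 1) z := by
        simpa [add_comm] using walkProb_mul_le p 1 n x (z - x)

theorem exists_pos_le_apply (hfull : ∀ x, 0 < p x) (K : ℕ) :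
    ∃ m : ℝ, 0 < m ∧ m ≤ 1 ∧ ∀ x : ℤ, |x| ≤ K → ENNReal.ofReal m ≤ p x := by
  obtain ⟨x₀, -, hx₀⟩ := (Finset.Icc (-K : ℤ) K).exists_min_image p ⟨0, by simp⟩
  refine ⟨(p x₀).toReal, ENNReal.toReal_pos (hfull x₀).ne' (p.apply_ne_top x₀),
    ENNReal.toReal_le_of_le_ofReal zero_le_one (by simpa using p.coe_le_one x₀), fun x hx => ?_⟩
  rw [ENNReal.ofReal_toReal (p.apply_ne_top x₀)]
  exact hx₀ x (Finset.mem_Icc.2 (abs_le.1 hx))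

theorem walkMass_pos (hfull : ∀ x, 0 < p x) {n : ℕ} (hn : 1 ≤ n) (z : ℤ) :
    0 < walkMass p n z := by
  obtain ⟨m, hm0, -, hm⟩ := exists_pos_le_apply hfull z.natAbs
  have h := pow_le_walkProb hm n (z := z) (by
    rw [Int.natCast_natAbs]
    exact le_mul_of_one_le_right (abs_nonneg z) (by exact_mod_cast hn))
  rw [← ENNReal.ofReal_pow hm0.le] at h
  exact ENNReal.toReal_pos
    ((ENNReal.ofReal_pos.2 (pow_pos hm0 n)).trans_le h).ne' (walkProb_ne_top p n z)

theorem exists_le_walkMass_floor (hfull : ∀ x, 0 < p x) (hp : StronglyUnimodal p)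
    (hl : 0 < l) (hfin : absMGF p l < ∞) :
    ∃ Δ : ℝ, 0 < Δ ∧ ∀ n : ℕ, 1 ≤ n → Δ / √n ≤ walkMass p n ⌊mean p * n⌋ := by
  obtain ⟨δ, hδ, h⟩ := eventually_le_walkMass_floor hfull hp hl hfin
  obtain ⟨N, hN⟩ := Filter.eventually_atTop.1 h
  obtain ⟨n₀, hn₀, hmin⟩ := (Finset.Icc 1 (N + 1)).exists_min_image
    (fun n : ℕ => walkMass p n ⌊mean p * n⌋ * √n) ⟨1, by simp⟩
  have hn₀1 := (Finset.mem_Icc.1 hn₀).1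
  have hn₀' : (0 : ℝ) < n₀ := by exact_mod_cast hn₀1
  have hpos := walkMass_pos hfull hn₀1 ⌊mean p * n₀⌋
  refine ⟨min δ (walkMass p n₀ ⌊mean p * n₀⌋ * √n₀), by positivity, fun n hn => ?_⟩
  have hn' : (0 : ℝ) < n := by exact_mod_cast hn
  rcases le_total N n with hNn | hNn
  · refine le_trans ?_ (hN n hNn)
    gcongr
    exact min_le_left _ _
  · rw [div_le_iff₀ (by positivity)]
    exact (min_le_right _ _).trans (hmin n (Finset.mem_Icc.2 ⟨hn, by omega⟩))

theorem exists_admissibleConstants (hfull : ∀ x, 0 < p x) (hp : StronglyUnimodal p)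
    (hl : 0 < l) (hfin : absMGF p l < ∞) :
    ∃ Δ R C c Chat chat : ℝ, AdmissibleConstants p l Δ R C c Chat chat := by
  obtain ⟨Δ, hΔ, hmean⟩ := exists_le_walkMass_floor hfull hp hl hfin
  set R : ℝ := |mean p| + 2 + Δ⁻¹ with hR
  obtain ⟨N, hN⟩ := exists_nat_ge (2 * R)
  obtain ⟨m, hm0, hm1, hm⟩ := exists_pos_le_apply hfull N
  have hlogm : Real.log m ≤ 0 := Real.log_nonpos hm0.le hm1
  set c : ℝ := 1 - Real.log m with hc
  have hc0 : 0 < c := by linarith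
  set K := (absMGF p l).toReal with hK
  have hK1 : 1 ≤ K := by
    rw [hK, ← ENNReal.toReal_one]
    exact ENNReal.toReal_mono hfin.ne (one_le_absMGF p hl.le)
  have hlogK : 0 ≤ Real.log K := Real.log_nonneg hK1
  refine ⟨Δ, R, 1, c, 8 / Δ + 1, Real.log K + (c + 1), hΔ, hmean, by linarith, one_pos, hc0,
    fun n hn z hz => ?_, by positivity, by positivity, fun n hn => ?_⟩
  · have hn' : (1 : ℝ) ≤ n := by exact_mod_cast hn
    have hzN : |z| ≤ N * n := by
      have : |(z : ℝ)| ≤ N * n := hz.trans (by gcongr)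
      exact_mod_cast this
    have h1 := pow_le_walkProb hm n hzN
    rw [← ENNReal.ofReal_pow hm0.le, ← ofReal_walkMass, ENNReal.ofReal_le_ofReal_iff
      (show 0 ≤ walkMass p n z from measureReal_nonneg)] at h1
    refine le_trans ?_ h1
    calc 1 / √(n : ℝ) * Real.exp (-c * n) ≤ 1 * Real.exp (Real.log m * n) := by
          gcongr
          · rw [div_le_one (by positivity)]; exact Real.one_le_sqrt.2 hn'
          · linarith
      _ = m ^ n := by rw [one_mul, mul_comm, Real.exp_nat_mul, Real.exp_log hm0]
  · have hn' : (1 : ℝ) ≤ n := by exact_mod_cast hn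
    have hq := Real.quadratic_le_exp_of_nonneg (x := (n : ℝ)) (by positivity)
    have h1 : (n : ℝ) ^ (3 / 2 : ℝ) ≤ 2 * Real.exp n := by
      calc (n : ℝ) ^ (3 / 2 : ℝ) ≤ (n : ℝ) ^ (2 : ℝ) :=
            Real.rpow_le_rpow_of_exponent_le hn' (by norm_num)
        _ = (n : ℝ) ^ 2 := Real.rpow_two _
        _ ≤ _ := by linarith
    have h2 : √(n : ℝ) ≤ Real.exp n := by
      have : √(n : ℝ) ≤ n := by rw [Real.sqrt_le_left (by positivity)]; nlinarith
      have h0 : 0 ≤ (n : ℝ) ^ 2 / 2 := by positivity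
      linarith
    have h3 : 1 ≤ Real.exp (c * n) := Real.one_le_exp (by positivity)
    calc K ^ n * (4 * (n : ℝ) ^ (3 / 2 : ℝ) / Δ + 1⁻¹ * √n * Real.exp (c * n))
        ≤ K ^ n * (4 * (2 * Real.exp n * Real.exp (c * n)) / Δ +
            Real.exp n * Real.exp (c * n)) := by
          rw [inv_one, one_mul]
          gcongr
          exact h1.trans (le_mul_of_one_le_right (by positivity) h3)
      _ = (8 / Δ + 1) * Real.exp ((Real.log K + (c + 1)) * n) := by
          have e1 : Real.exp ((Real.log K + (c + 1)) * n) =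
              K ^ n * (Real.exp n * Real.exp (c * n)) := by
            rw [← Real.exp_add, ← Real.exp_log (show 0 < K by linarith), ← Real.exp_nat_mul,
              ← Real.exp_add, Real.log_exp]
            congr 1; ring
          rw [e1]; ring

end Existence

end DiscreteBridge

open DiscreteBridge in
theorem lemma7p2 (p : PMF ℤ) (α : WithBot ℤ) (β : WithTop ℤ)
    (hsupp : DiscreteBridge.IntervalSupport p α β)
    (hexp : DiscreteBridge.HasExpMoment p)
    (hlsc : LowerSemicontinuous (DiscreteBridge.logMGF p))
    (htail : DiscreteBridge.OneSidedGaussianTail p) :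
    ((α ≠ ⊥ ∨ β ≠ ⊤ ∨ (α = ⊥ ∧ β = ⊤ ∧ DiscreteBridge.StronglyUnimodal p)) →
      DiscreteBridge.BridgeMaxBound p α β) ∧
    (∀ a : ℤ, α = (a : WithBot ℤ) →
      DiscreteBridge.BridgeMaxBoundWith p α β
        (fun _ => 1) (fun b => b / (1 + b + |(a : ℝ)|))) ∧
    (∀ a : ℤ, β = (a : WithTop ℤ) →
      DiscreteBridge.BridgeMaxBoundWith p α β
        (fun _ => 1) (fun b => b / (1 + b + |(a : ℝ)|))) ∧
    (α = ⊥ → β = ⊤ → DiscreteBridge.StronglyUnimodal p →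
      ∀ l : ℝ, 0 < l → DiscreteBridge.absMGF p l < ⊤ →
        (∃ Δ R C c Chat chat : ℝ,
          DiscreteBridge.AdmissibleConstants p l Δ R C c Chat chat) ∧
        (∀ Δ R C c Chat chat : ℝ,
          DiscreteBridge.AdmissibleConstants p l Δ R C c Chat chat →
          ∀ v : ℝ → ℕ,
            (∀ b : ℝ, 0 < b →
              1 ≤ v b ∧ chat / (v b : ℝ) ≤ b / 2 ∧ l / (v b : ℝ) ≤ b / 2) →
            DiscreteBridge.BridgeMaxBoundWith p α β
              (fun b => Chat ^ (1 / (v b : ℝ))) (fun b => l / (v b : ℝ)))) := by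
  have hleft (a : ℤ) (ha : α = (a : WithBot ℤ)) : BridgeMaxBoundWith p α β
      (fun _ => 1) (fun b => b / (1 + b + |(a : ℝ)|)) := by
    refine bridgeMaxBoundWith_of_bounded_side p α β a (.inl fun x hx => ?_)
    have h := ((hsupp.pos_iff x).1 hx).1
    rw [ha] at h
    exact WithBot.coe_le_coe.1 h
  have hright (a : ℤ) (ha : β = (a : WithTop ℤ)) : BridgeMaxBoundWith p α β
      (fun _ => 1) (fun b => b / (1 + b + |(a : ℝ)|)) := by
    refine bridgeMaxBoundWith_of_bounded_side p α β a (.inr fun x hx => ?_)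
    have h := ((hsupp.pos_iff x).1 hx).2
    rw [ha] at h
    exact WithTop.coe_le_coe.1 h
  have hfull (hα : α = ⊥) (hβ : β = ⊤) (x : ℤ) : 0 < p x :=
    (hsupp.pos_iff x).2 (by simp [hα, hβ])
  refine ⟨?_, hleft, hright, fun hα hβ hp l hl hfin =>
    ⟨exists_admissibleConstants (hfull hα hβ) hp hl hfin,
      fun Δ R C c Chat chat h v hv =>
        bridgeMaxBoundWith_of_stronglyUnimodal α β hp h hl hfin v hv⟩⟩
  rintro (h | h | ⟨hα, hβ, hp⟩)
  · obtain ⟨a, ha⟩ := WithBot.ne_bot_iff_exists.1 h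
    exact ⟨_, _, hleft a ha.symm⟩
  · obtain ⟨a, ha⟩ := WithTop.ne_top_iff_exists.1 h
    exact ⟨_, _, hright a ha.symm⟩
  · obtain ⟨l, hl, hfin⟩ := hexp
    obtain ⟨Δ, R, C, c, Chat, chat, h⟩ := exists_admissibleConstants (hfull hα hβ) hp hl hfin
    refine ⟨_, _, bridgeMaxBoundWith_of_stronglyUnimodal α β hp h hl hfin
      (fun b => ⌈2 * (chat + l) / b⌉₊ + 1) fun b hb => ⟨by omega, ?_⟩⟩
    have hchat := h.chat_pos
    have hle : 2 * (chat + l) / b ≤ ((⌈2 * (chat + l) / b⌉₊ + 1 : ℕ) : ℝ) := by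
      push_cast
      linarith [Nat.le_ceil (2 * (chat + l) / b)]
    have hv : (0 : ℝ) < ((⌈2 * (chat + l) / b⌉₊ + 1 : ℕ) : ℝ) := by positivity
    rw [div_le_iff₀ hb] at hle
    constructor <;> rw [div_le_iff₀ hv] <;> linarith
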